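/- For a finite graph $G=(V,E)$ let $i(G)$ be the number of independent sets of $G$ (including the empty set), and let its average degree be $\frac{1}{|V|}\sum_{v\in V}\deg(v)$. Let $W$ be the Lambert $W$ function on $\mathbb{R}_{\ge 0}$, that is, the inverse of the function $\mathbb{R}_{\ge 0}\to\mathbb{R}_{\ge 0}$, $x\mapsto xe^x$. Let $\mathcal{F}_1:\mathbb{R}_{\ge 0}\to\mathbb{R}_{\ge 0}$ be defined by \[\mathcal{F}_1(d)=\inf\left\{\frac{\log i(G)}{|V|} : G=(V,E)\text{ a finite triangle-free graph with } V\neq\varnothing \text{ and average degree at most } d\right\}.\] Then for all $d\ge 0$ \[\frac{W(d)^2+2W(d)-W(2)^2-2W(2)}{2(d-2)}\le \mathcal{F}_1(d)\le\frac{W(d)^2+2W(d)}{2d},\] where the left-hand side at $d=2$ and the right-hand side at $d=0$, which formally read $0/0$, are understood as the values of the continuous extensions to $[0,\infty)$, namely $W(2)/2$ and $1$, respectively. -/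

import Mathlib

/-- The Lambert `W` function on the nonnegative reals: the inverse of the map `x ↦ x * exp x`
from `[0, ∞)` to `[0, ∞)` (arguments below `0` are never used). -/
noncomputable def lambertW (y : ℝ) : ℝ :=
  Function.invFunOn (fun x : ℝ => x * Real.exp x) (Set.Ici 0) y

/-- For `y ≥ 0`, `lambertW y` is a nonnegative solution `x` of `x * exp x = y`. -/
theorem lambertW_spec {y : ℝ} (hy : 0 ≤ y) :
    0 ≤ lambertW y ∧ lambertW y * Real.exp (lambertW y) = y := by
  have hex : ∃ x ∈ Set.Ici (0 : ℝ), (fun x : ℝ => x * Real.exp x) x = y := by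
    have hcont : ContinuousOn (fun x : ℝ => x * Real.exp x) (Set.Icc 0 y) := by fun_prop
    have hle : y ≤ y * Real.exp y :=
      le_mul_of_one_le_right hy (Real.one_le_exp hy)
    obtain ⟨x, hx, hxy⟩ := intermediate_value_Icc hy hcont
      (show y ∈ Set.Icc ((fun x : ℝ => x * Real.exp x) 0) ((fun x : ℝ => x * Real.exp x) y) from
        ⟨by simpa using hy, hle⟩)
    exact ⟨x, hx.1, hxy⟩
  exact ⟨Function.invFunOn_mem hex, Function.invFunOn_eq hex⟩

/-- `lambertW` is a left inverse of `x ↦ x * exp x` on `[0, ∞)`. -/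
theorem lambertW_mul_exp {x : ℝ} (hx : 0 ≤ x) : lambertW (x * Real.exp x) = x := by
  obtain ⟨h0, h1⟩ := lambertW_spec (mul_nonneg hx (Real.exp_pos x).le)
  have key : ∀ a b : ℝ, 0 ≤ a → a < b → a * Real.exp a < b * Real.exp b := fun a b ha hab =>
    mul_lt_mul hab (Real.exp_le_exp.2 hab.le) (Real.exp_pos a) (ha.trans hab.le)
  rcases lt_trichotomy (lambertW (x * Real.exp x)) x with h | h | h
  · exact absurd h1 (key _ _ h0 h).ne
  · exact h
  · exact absurd h1 (key _ _ hx h).ne'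

open Classical in
/-- The average degree `(1 / |V|) * ∑ v, deg v` of a finite graph (it is `0` if `V` is empty). -/
noncomputable def avgDegree {V : Type} [Fintype V] (G : SimpleGraph V) : ℝ :=
  (∑ v : V, (G.degree v : ℝ)) / (Fintype.card V : ℝ)

open Classical in
/-- The number of independent sets of a finite graph, the empty set included. -/
noncomputable def numIndepSets {V : Type} [Fintype V] (G : SimpleGraph V) : ℕ :=
  (Finset.univ.filter fun s : Finset V => G.IsIndepSet (s : Set V)).card

/-- The values `log (i(G)) / |V|`, where `G` runs over the finite triangle-free graphs with at
least one vertex and average degree at most `d`. -/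
def logIndepDensities (d : ℝ) : Set ℝ :=
  {x | ∃ (V : Type) (_ : Fintype V) (_ : Nonempty V) (G : SimpleGraph V),
    G.CliqueFree 3 ∧ avgDegree G ≤ d ∧
      x = Real.log (numIndepSets G) / (Fintype.card V : ℝ)}

/-- The extremal function `F₁`. -/
noncomputable def extremalF (d : ℝ) : ℝ := sInf (logIndepDensities d)

/-- For `d ≥ 0` the infimum is over a nonempty set. -/
theorem logIndepDensities_nonempty {d : ℝ} (hd : 0 ≤ d) : (logIndepDensities d).Nonempty := by
  refine ⟨_, Fin 1, inferInstance, inferInstance, ⊥, ?_, ?_, rfl⟩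
  · exact SimpleGraph.cliqueFree_bot (by norm_num)
  · simpa [avgDegree] using hd

/-- The infimum is over a set that is bounded below by `0`. -/
theorem logIndepDensities_nonneg {d x : ℝ} (hx : x ∈ logIndepDensities d) : 0 ≤ x := by
  obtain ⟨V, _, _, G, -, -, rfl⟩ := hx
  exact div_nonneg (Real.log_natCast_nonneg _) (Nat.cast_nonneg _)

/-- The lower curve. At `d = 2`, where the quotient reads `0 / 0`, it has the value of the
continuous extension. -/
noncomputable def lowerCurve (d : ℝ) : ℝ :=
  if d = 2 then lambertW 2 / 2
  else (lambertW d ^ 2 + 2 * lambertW d - lambertW 2 ^ 2 - 2 * lambertW 2) / (2 * (d - 2))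

/-- The upper curve. At `d = 0`, where the quotient reads `0 / 0`, it has the value of the
continuous extension. -/
noncomputable def upperCurve (d : ℝ) : ℝ :=
  if d = 0 then 1
  else (lambertW d ^ 2 + 2 * lambertW d) / (2 * d)

/-!
Put `x t = exp (-W t)`, which equals `W t / t` for `t > 0`. The lower curve `f d` is the mean of `x`
over the interval between `2` and `d`. Since `x` is convex and decreasing, so is `f`, and
`f d + (d - 2) * f' d = x d`.

Lower bound (Shearer's induction): let `G` be triangle-free with average degree `d`. For every
vertex `v`, `i G` is the sum of the numbers of independent sets of `G - v` and of `G - v - N(v)`.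
Both are bounded below by induction and the tangent line of `f` at `d`; the number of edges left in
`G - v - N(v)` is controlled because `N(v)` is independent. Averaging over `v` (Jensen and
Cauchy–Schwarz), the induction closes as soon as
`1 ≤ exp (-f d - d * f' d) + exp (-(1 + d) * f d + (d - d ^ 2) * f' d)`, which by the differential
equation means `x d + 2 * f' d ≤ log (1 + x d)`. Since `log (1 + x) ≥ 2 * x / (x + 2)`, a bound on
`f' d` suffices, and that is the minimality of a function of `W d` at `W 2`, where `d = 2`.

Upper bound: add about `d * n / 2` random edges to the empty graph on `n` vertices, skipping those
that would create a triangle or a vertex of degree greater than a cap `D`. Few pairs are skipped, so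
an independent set `I` survives each step with probability at most about `1 - (|I| / n) ^ 2`.
Choosing the steps greedily instead of randomly gives a graph with at most
`∑ I, (1 - (|I| / n) ^ 2 + ε) ^ (d * n / 2)` independent sets. Linearizing `(|I| / n) ^ 2` at
`x d`, the fixed point of `y ↦ exp (-d * y)`, bounds the sum by the exponential of `n` times the
upper curve, up to errors that vanish as `n → ∞` and then `D → ∞`.
-/

section Subgradient

variable {g g' : ℝ → ℝ} {C : Set ℝ} {a d : ℝ}

/-- `g' x` is a subgradient at `x` of the restriction of `g` to `C`, for every `x ∈ C`. Subgradients
are used instead of derivatives because the endpoint `0` of `[0, ∞)` is included. -/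
def IsSubgradientOn (g' g : ℝ → ℝ) (C : Set ℝ) : Prop :=
  ∀ ⦃x⦄, x ∈ C → ∀ ⦃y⦄, y ∈ C → g x + g' x * (y - x) ≤ g y

theorem IsSubgradientOn.antitoneOn (h : IsSubgradientOn g' g C) (hg' : ∀ x ∈ C, g' x ≤ 0) :
    AntitoneOn g C := fun x hx y hy hxy => by
  have := mul_nonneg_of_nonpos_of_nonpos (hg' y hy) (sub_nonpos.2 hxy)
  linarith [h hy hx]

theorem isSubgradientOn_Ici_of_monotoneOn (hg' : MonotoneOn g' (Set.Ici a))
    (hg : ContinuousOn g (Set.Ici a)) (h : ∀ x, a < x → HasDerivAt g (g' x) x) :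
    IsSubgradientOn g' g (Set.Ici a) := by
  have mean_value {u v : ℝ} (hu : a ≤ u) (huv : u < v) :
      ∃ c ∈ Set.Ioo u v, g' c * (v - u) = g v - g u := by
    obtain ⟨c, hc, hslope⟩ := exists_hasDerivAt_eq_slope g g' huv
      (hg.mono (Set.Icc_subset_Ici_self.trans (Set.Ici_subset_Ici.2 hu)))
      fun x hx => h x (hu.trans_lt hx.1)
    exact ⟨c, hc, by rw [hslope, div_mul_cancel₀ _ (sub_pos.2 huv).ne']⟩
  intro x hx y hy
  rcases lt_trichotomy x y with hxy | rfl | hyx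
  · obtain ⟨c, hc, hslope⟩ := mean_value hx hxy
    have hxc := hg' hx (le_trans hx hc.1.le : a ≤ c) hc.1.le
    linarith [mul_le_mul_of_nonneg_right hxc (sub_pos.2 hxy).le]
  · simp
  · obtain ⟨c, hc, hslope⟩ := mean_value hy hyx
    have hcx := hg' (le_trans hy hc.1.le : a ≤ c) hx hc.2.le
    linarith [mul_le_mul_of_nonneg_right hcx (sub_pos.2 hyx).le]

/-- The mean of `g` over the interval between `a` and `d`, with value `g a` at `d = a`. -/
noncomputable def segmentMean (g : ℝ → ℝ) (a d : ℝ) : ℝ :=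
  ∫ s in (0 : ℝ)..1, g (a + s * (d - a))

/-- The derivative of `segmentMean g a` at `d`, when `g'` is the derivative of `g`. -/
noncomputable def segmentSlope (g' : ℝ → ℝ) (a d : ℝ) : ℝ :=
  ∫ s in (0 : ℝ)..1, s * g' (a + s * (d - a))

theorem continuous_segmentMean (hg : Continuous g) (a : ℝ) : Continuous (segmentMean g a) :=
  intervalIntegral.continuous_parametric_intervalIntegral_of_continuous'
    (f := fun d s => g (a + s * (d - a))) (by fun_prop) 0 1

theorem segmentMean_self (g : ℝ → ℝ) (a : ℝ) : segmentMean g a a = g a := by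
  simp [segmentMean]

theorem segmentSlope_self (g' : ℝ → ℝ) (a : ℝ) : segmentSlope g' a a = g' a / 2 := by
  simp only [segmentSlope, sub_self, mul_zero, add_zero, intervalIntegral.integral_mul_const,
    integral_id]
  ring

theorem sub_mul_segmentMean (g : ℝ → ℝ) (a d : ℝ) :
    (d - a) * segmentMean g a d = ∫ t in a..d, g t := by
  have h := intervalIntegral.mul_integral_comp_add_mul (f := g) (a := 0) (b := 1) (d - a) a
  simpa [segmentMean, mul_comm] using h

theorem segmentMean_add_sub_mul_segmentSlope (hg : Continuous g) (hg' : Continuous g')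
    (h : ∀ t ∈ openSegment ℝ a d, HasDerivAt g (g' t) t) :
    segmentMean g a d + (d - a) * segmentSlope g' a d = g d := by
  have hderiv (s : ℝ) (hs : s ∈ Set.Ioo 0 1) :
      HasDerivAt (fun s => s * g (a + s * (d - a)))
        (g (a + s * (d - a)) + (d - a) * (s * g' (a + s * (d - a)))) s := by
    have hline : HasDerivAt (fun s : ℝ => a + s * (d - a)) (d - a) s := by
      simpa using ((hasDerivAt_id s).mul_const (d - a)).const_add a
    have hmem : a + s * (d - a) ∈ openSegment ℝ a d := by
      rw [openSegment_eq_image']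
      exact ⟨s, hs, rfl⟩
    exact ((hasDerivAt_id s).mul ((h _ hmem).comp s hline)).congr_deriv (by simp; ring)
  have hint := intervalIntegral.integral_eq_sub_of_hasDerivAt_of_le zero_le_one
    (by fun_prop) hderiv (Continuous.intervalIntegrable (by fun_prop) 0 1)
  rw [intervalIntegral.integral_add (Continuous.intervalIntegrable (by fun_prop) 0 1)
    (Continuous.intervalIntegrable (by fun_prop) 0 1), intervalIntegral.integral_const_mul] at hint
  simpa [segmentMean, segmentSlope] using hint

theorem isSubgradientOn_segmentMean (h : IsSubgradientOn g' g C) (hC : Convex ℝ C) (ha : a ∈ C)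
    (hg : Continuous g) (hg' : Continuous g') :
    IsSubgradientOn (segmentSlope g' a) (segmentMean g a) C := by
  intro x hx y hy
  unfold segmentMean segmentSlope
  rw [← intervalIntegral.integral_mul_const, ← intervalIntegral.integral_add
    (Continuous.intervalIntegrable (by fun_prop) 0 1)
    (Continuous.intervalIntegrable (by fun_prop) 0 1)]
  refine intervalIntegral.integral_mono_on zero_le_one
    (Continuous.intervalIntegrable (by fun_prop) 0 1)
    (Continuous.intervalIntegrable (by fun_prop) 0 1) fun s hs => ?_
  have hs' := h (hC.add_smul_sub_mem ha hx hs) (hC.add_smul_sub_mem ha hy hs)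
  simp only [smul_eq_mul] at hs'
  linarith

theorem segmentSlope_nonpos (hg' : ∀ t, g' t ≤ 0) (a d : ℝ) : segmentSlope g' a d ≤ 0 := by
  rw [segmentSlope, intervalIntegral.integral_of_le zero_le_one]
  exact MeasureTheory.setIntegral_nonpos measurableSet_Ioc fun s hs =>
    mul_nonpos_of_nonneg_of_nonpos hs.1.le (hg' _)

end Subgradient

section LambertW

theorem sub_le_mul_exp_sub_mul_exp {a b : ℝ} (ha : 0 ≤ a) (hab : a ≤ b) :
    b - a ≤ b * Real.exp b - a * Real.exp a :=
  calc b - a ≤ (b - a) * Real.exp b :=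
        le_mul_of_one_le_right (sub_nonneg.2 hab) (Real.one_le_exp (ha.trans hab))
    _ = b * Real.exp b - a * Real.exp b := sub_mul _ _ _
    _ ≤ b * Real.exp b - a * Real.exp a := by gcongr

theorem monotoneOn_lambertW : MonotoneOn lambertW (Set.Ici 0) := by
  intro a ha b hb hab
  by_contra! h
  obtain ⟨hb0, hb_eq⟩ := lambertW_spec hb
  obtain ⟨-, ha_eq⟩ := lambertW_spec ha
  linarith [sub_le_mul_exp_sub_mul_exp hb0 h.le]

/-- The function `lambertW`, extended by `0` to the negative reals, where `lambertW` has junk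
values, so that it is continuous on the whole line. -/
noncomputable def clampedW (t : ℝ) : ℝ := lambertW (max t 0)

theorem clampedW_of_nonneg {t : ℝ} (ht : 0 ≤ t) : clampedW t = lambertW t := by
  rw [clampedW, max_eq_left ht]

theorem clampedW_nonneg (t : ℝ) : 0 ≤ clampedW t := (lambertW_spec (le_max_right t 0)).1

theorem clampedW_mul_exp {t : ℝ} (ht : 0 ≤ t) : clampedW t * Real.exp (clampedW t) = t := by
  rw [clampedW_of_nonneg ht, (lambertW_spec ht).2]

theorem monotone_clampedW : Monotone clampedW := fun s t hst =>
  monotoneOn_lambertW (le_max_right s 0) (le_max_right t 0) (max_le_max_right 0 hst)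

theorem continuous_clampedW : Continuous clampedW := by
  have hlip : LipschitzOnWith 1 lambertW (Set.Ici 0) := by
    refine LipschitzOnWith.of_le_add fun s hs t ht => ?_
    obtain ⟨-, hs_eq⟩ := lambertW_spec hs
    obtain ⟨ht0, ht_eq⟩ := lambertW_spec ht
    rcases le_total s t with hst | hts
    · exact (monotoneOn_lambertW hs ht hst).trans (le_add_of_nonneg_right dist_nonneg)
    · have := sub_le_mul_exp_sub_mul_exp ht0 (monotoneOn_lambertW ht hs hts)
      linarith [Real.dist_eq s t, le_abs_self (s - t)]
  exact hlip.continuousOn.comp_continuous (by fun_prop) fun t => le_max_right t 0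

theorem hasDerivAt_clampedW {t : ℝ} (ht : 0 < t) :
    HasDerivAt clampedW (Real.exp (-clampedW t) / (1 + clampedW t)) t := by
  have hW := clampedW_nonneg t
  have hinv : HasDerivAt (fun x : ℝ => x * Real.exp x)
      ((1 + clampedW t) * Real.exp (clampedW t)) (clampedW t) :=
    ((hasDerivAt_id _).mul (Real.hasDerivAt_exp _)).congr_deriv (by simp; ring)
  have hne : (1 + clampedW t) * Real.exp (clampedW t) ≠ 0 := by positivity
  refine (HasDerivAt.of_local_left_inverse continuous_clampedW.continuousAt hinv hne
    ?_).congr_deriv ?_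
  · filter_upwards [lt_mem_nhds ht] with y hy using clampedW_mul_exp hy.le
  · rw [Real.exp_neg]
    field_simp

theorem hasDerivAt_clampedW_sq_div_two_add {t : ℝ} (ht : 0 < t) :
    HasDerivAt (fun t => clampedW t ^ 2 / 2 + clampedW t) (Real.exp (-clampedW t)) t := by
  have hW := clampedW_nonneg t
  have h := hasDerivAt_clampedW ht
  refine (((h.pow 2).div_const 2).add h).congr_deriv ?_
  field_simp
  push_cast
  ring

/-- The function `t ↦ exp (-W t)`, that is `W t / t` with its singularity at `0` removed. -/
noncomputable def expNegW (t : ℝ) : ℝ := Real.exp (-clampedW t)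

/-- The derivative of `expNegW` on the positive reals. -/
noncomputable def expNegWDeriv (t : ℝ) : ℝ := -(expNegW t ^ 2 / (1 + clampedW t))

theorem expNegW_pos (t : ℝ) : 0 < expNegW t := Real.exp_pos _

theorem expNegW_le_one (t : ℝ) : expNegW t ≤ 1 :=
  Real.exp_le_one_iff.2 (neg_nonpos.2 (clampedW_nonneg t))

theorem antitone_expNegW : Antitone expNegW := fun _ _ hst =>
  Real.exp_le_exp.2 (neg_le_neg (monotone_clampedW hst))

theorem continuous_expNegW : Continuous expNegW :=
  Real.continuous_exp.comp continuous_clampedW.neg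

theorem mul_expNegW {t : ℝ} (ht : 0 ≤ t) : t * expNegW t = clampedW t := by
  rw [expNegW, Real.exp_neg, ← div_eq_mul_inv, div_eq_iff (Real.exp_ne_zero _),
    clampedW_mul_exp ht]

theorem exp_neg_mul_expNegW {t : ℝ} (ht : 0 ≤ t) : Real.exp (-(t * expNegW t)) = expNegW t := by
  rw [mul_expNegW ht, expNegW]

theorem hasDerivAt_expNegW {t : ℝ} (ht : 0 < t) : HasDerivAt expNegW (expNegWDeriv t) t := by
  refine (hasDerivAt_clampedW ht).neg.exp.congr_deriv ?_
  simp only [expNegWDeriv, expNegW, Pi.neg_apply]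
  ring

theorem expNegWDeriv_nonpos (t : ℝ) : expNegWDeriv t ≤ 0 := by
  have := clampedW_nonneg t
  rw [expNegWDeriv, neg_nonpos]
  positivity

theorem monotone_expNegWDeriv : Monotone expNegWDeriv := by
  intro s t hst
  have hWs := clampedW_nonneg s
  have hx := (expNegW_pos t).le
  have hW := monotone_clampedW hst
  have hx_anti := antitone_expNegW hst
  unfold expNegWDeriv
  gcongr

theorem continuous_expNegWDeriv : Continuous expNegWDeriv :=
  ((continuous_expNegW.pow 2).div (continuous_clampedW.const_add 1) fun t =>
    (add_pos_of_pos_of_nonneg one_pos (clampedW_nonneg t)).ne').neg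

theorem isSubgradientOn_expNegW : IsSubgradientOn expNegWDeriv expNegW (Set.Ici 0) :=
  isSubgradientOn_Ici_of_monotoneOn (monotone_expNegWDeriv.monotoneOn _)
    continuous_expNegW.continuousOn fun _ => hasDerivAt_expNegW

theorem sub_mul_segmentMean_expNegW {a d : ℝ} (ha : 0 ≤ a) (hd : 0 ≤ d) :
    (d - a) * segmentMean expNegW a d =
      (clampedW d ^ 2 / 2 + clampedW d) - (clampedW a ^ 2 / 2 + clampedW a) := by
  rw [sub_mul_segmentMean]
  refine intervalIntegral.integral_eq_sub_of_hasDeriv_right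
    (((continuous_clampedW.pow 2).div_const 2).add continuous_clampedW).continuousOn
    (fun t ht => ?_) (continuous_expNegW.intervalIntegrable a d)
  exact (hasDerivAt_clampedW_sq_div_two_add ((le_min ha hd).trans_lt ht.1)).hasDerivWithinAt

end LambertW

section Curves

theorem lowerCurve_eq_segmentMean {d : ℝ} (hd : 0 ≤ d) :
    lowerCurve d = segmentMean expNegW 2 d := by
  unfold lowerCurve
  rw [← clampedW_of_nonneg hd, ← clampedW_of_nonneg zero_le_two]
  split_ifs with h
  · rw [h, segmentMean_self, ← mul_expNegW zero_le_two]
    ring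
  · rw [div_eq_iff (mul_ne_zero two_ne_zero (sub_ne_zero.2 h))]
    linear_combination -2 * sub_mul_segmentMean_expNegW zero_le_two hd

theorem upperCurve_eq_expNegW {d : ℝ} (hd : 0 ≤ d) :
    upperCurve d = expNegW d + d * expNegW d ^ 2 / 2 := by
  have hW := mul_expNegW hd
  unfold upperCurve
  rw [← clampedW_of_nonneg hd]
  split_ifs with h
  · subst h
    have h0 : clampedW 0 = 0 := by simpa using hW.symm
    simp [expNegW, h0]
  · rw [← hW]
    field_simp
    ring

theorem continuousOn_lowerCurve : ContinuousOn lowerCurve (Set.Ici 0) :=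
  (continuous_segmentMean continuous_expNegW 2).continuousOn.congr fun _ =>
    lowerCurve_eq_segmentMean

theorem continuousOn_upperCurve : ContinuousOn upperCurve (Set.Ici 0) := by
  have := continuous_expNegW
  exact ContinuousOn.congr (f := fun d => expNegW d + d * expNegW d ^ 2 / 2) (by fun_prop)
    fun _ => upperCurve_eq_expNegW

theorem isSubgradientOn_segmentMean_expNegW :
    IsSubgradientOn (segmentSlope expNegWDeriv 2) (segmentMean expNegW 2) (Set.Ici 0) :=
  isSubgradientOn_segmentMean isSubgradientOn_expNegW (convex_Ici 0)
    (Set.mem_Ici.2 zero_le_two) continuous_expNegW continuous_expNegWDeriv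

theorem segmentMean_expNegW_add {a d : ℝ} (ha : 0 < a) (hd : 0 ≤ d) :
    segmentMean expNegW a d + (d - a) * segmentSlope expNegWDeriv a d = expNegW d := by
  refine segmentMean_add_sub_mul_segmentSlope continuous_expNegW continuous_expNegWDeriv
    fun t ht => hasDerivAt_expNegW ?_
  obtain ⟨u, v, hu, hv, -, rfl⟩ := ht
  simp only [smul_eq_mul]
  positivity

/-- The difference `slopeGap w - slopeGap (W 2)` is the slack, multiplied by `(d - 2) ^ 2`, in the
bound on `segmentSlope expNegWDeriv 2 d`, written in terms of `w = W d`. -/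
noncomputable def slopeGap (w : ℝ) : ℝ :=
  w ^ 2 + 4 * Real.exp (-w) - (w - 2 * Real.exp (-w)) ^ 2 / (Real.exp (-w) + 2)

theorem hasDerivAt_slopeGap (w : ℝ) : HasDerivAt slopeGap
    ((w - 2 * Real.exp (-w)) *
      ((4 - Real.exp (-w) * (w + 2)) / (Real.exp (-w) + 2) ^ 2)) w := by
  have hpos : Real.exp (-w) + 2 ≠ 0 := by positivity
  have hx : HasDerivAt (fun w : ℝ => Real.exp (-w)) (-Real.exp (-w)) w := by
    simpa using (hasDerivAt_neg w).exp
  refine ((((hasDerivAt_id w).pow 2).add (hx.const_mul 4)).sub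
    ((((hasDerivAt_id w).sub (hx.const_mul 2)).pow 2).div (hx.add_const 2) hpos)).congr_deriv ?_
  simp only [id, Pi.sub_apply, Pi.pow_apply]
  field_simp
  ring

theorem slopeGap_deriv_factor_nonneg {w : ℝ} (hw : 0 ≤ w) :
    0 ≤ (4 - Real.exp (-w) * (w + 2)) / (Real.exp (-w) + 2) ^ 2 := by
  have hexp : Real.exp (-w) * (w + 1) ≤ 1 := by
    calc Real.exp (-w) * (w + 1) ≤ Real.exp (-w) * Real.exp w := by
          gcongr
          exact Real.add_one_le_exp w
      _ = 1 := by rw [← Real.exp_add, neg_add_cancel, Real.exp_zero]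
  have hle : Real.exp (-w) ≤ 1 := Real.exp_le_one_iff.2 (neg_nonpos.2 hw)
  exact div_nonneg (by linarith) (by positivity)

theorem slopeGap_le_of_eq_two_mul_exp_neg {w₀ w : ℝ} (hw₀ : w₀ = 2 * Real.exp (-w₀))
    (hw : 0 ≤ w) : slopeGap w₀ ≤ slopeGap w := by
  have hw₀_nonneg : 0 ≤ w₀ := by rw [hw₀]; positivity
  have hdiff : Differentiable ℝ slopeGap := fun w => (hasDerivAt_slopeGap w).differentiableAt
  rcases le_total w₀ w with h | h
  · refine monotoneOn_of_deriv_nonneg (convex_Ici w₀) hdiff.continuous.continuousOn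
      hdiff.differentiableOn (fun x hx => ?_) Set.self_mem_Ici h h
    rw [interior_Ici, Set.mem_Ioi] at hx
    have hexp : Real.exp (-x) ≤ Real.exp (-w₀) := by gcongr
    rw [(hasDerivAt_slopeGap x).deriv]
    exact mul_nonneg (by linarith) (slopeGap_deriv_factor_nonneg (hw₀_nonneg.trans hx.le))
  · refine antitoneOn_of_deriv_nonpos (convex_Icc 0 w₀) hdiff.continuous.continuousOn
      hdiff.differentiableOn (fun x hx => ?_) ⟨hw, h⟩ ⟨hw₀_nonneg, le_rfl⟩ h
    rw [interior_Icc] at hx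
    have hexp : Real.exp (-w₀) ≤ Real.exp (-x) := Real.exp_le_exp.2 (neg_le_neg hx.2.le)
    rw [(hasDerivAt_slopeGap x).deriv]
    exact mul_nonpos_of_nonpos_of_nonneg (by linarith [hx.2])
      (slopeGap_deriv_factor_nonneg hx.1.le)

theorem slopeGap_clampedW {t : ℝ} (ht : 0 ≤ t) : slopeGap (clampedW t) =
    clampedW t ^ 2 + 4 * expNegW t - expNegW t ^ 2 * (t - 2) ^ 2 / (expNegW t + 2) := by
  rw [slopeGap, ← expNegW, ← mul_expNegW ht]
  ring

theorem two_mul_segmentSlope_expNegWDeriv_le {d : ℝ} (hd : 0 ≤ d) :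
    2 * segmentSlope expNegWDeriv 2 d ≤ -(expNegW d ^ 2 / (expNegW d + 2)) := by
  have hx := expNegW_pos d
  have hW2 := mul_expNegW zero_le_two
  rcases eq_or_ne d 2 with rfl | hd2
  · have hle : expNegW 2 ^ 2 / (expNegW 2 + 2) ≤ expNegW 2 ^ 2 / (1 + clampedW 2) := by
      rw [← hW2]
      exact div_le_div_of_nonneg_left (by positivity) (by positivity)
        (by linarith [expNegW_le_one 2])
    rw [segmentSlope_self, expNegWDeriv]
    linarith
  · have hgap := slopeGap_le_of_eq_two_mul_exp_neg hW2.symm (clampedW_nonneg d)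
    rw [slopeGap_clampedW zero_le_two, slopeGap_clampedW hd, sub_self,
      zero_pow two_ne_zero, mul_zero, zero_div, sub_zero] at hgap
    refine le_of_mul_le_mul_right ?_ (sq_pos_of_ne_zero (sub_ne_zero.2 hd2))
    calc 2 * segmentSlope expNegWDeriv 2 d * (d - 2) ^ 2
        = clampedW 2 ^ 2 + 4 * expNegW 2 - (clampedW d ^ 2 + 4 * expNegW d) := by
          linear_combination 2 * (d - 2) * segmentMean_expNegW_add two_pos hd -
            2 * sub_mul_segmentMean_expNegW zero_le_two hd + 2 * mul_expNegW hd - 2 * hW2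
      _ ≤ -(expNegW d ^ 2 * (d - 2) ^ 2 / (expNegW d + 2)) := by linarith
      _ = -(expNegW d ^ 2 / (expNegW d + 2)) * (d - 2) ^ 2 := by ring

theorem expNegW_add_two_mul_segmentSlope_le {d : ℝ} (hd : 0 ≤ d) :
    expNegW d + 2 * segmentSlope expNegWDeriv 2 d ≤ Real.log (1 + expNegW d) := by
  have hx := expNegW_pos d
  calc expNegW d + 2 * segmentSlope expNegWDeriv 2 d
      ≤ expNegW d + -(expNegW d ^ 2 / (expNegW d + 2)) := by
        gcongr
        exact two_mul_segmentSlope_expNegWDeriv_le hd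
    _ = 2 * expNegW d / (expNegW d + 2) := by
        field_simp
        ring
    _ ≤ Real.log (1 + expNegW d) := Real.le_log_one_add_of_nonneg hx.le

end Curves

section IndependentSubsets

open Finset

variable {V : Type*} {G : SimpleGraph V} {S T : Finset V} {v : V}

open Classical in
/-- The neighbours of `v` in the subgraph of `G` induced on `S`. -/
noncomputable def neighborsIn (G : SimpleGraph V) (S : Finset V) (v : V) : Finset V :=
  S.filter (G.Adj v)

/-- The degree of `v` in the subgraph of `G` induced on `S`. -/
noncomputable def degreeIn (G : SimpleGraph V) (S : Finset V) (v : V) : ℕ :=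
  #(neighborsIn G S v)

/-- The degree sum of the subgraph of `G` induced on `S`. -/
noncomputable def degreeSumIn (G : SimpleGraph V) (S : Finset V) : ℕ :=
  ∑ v ∈ S, degreeIn G S v

open Classical in
/-- The number of independent sets of the subgraph of `G` induced on `S`. -/
noncomputable def numIndepSetsIn (G : SimpleGraph V) (S : Finset V) : ℕ :=
  #(S.powerset.filter fun I : Finset V => G.IsIndepSet (I : Set V))

theorem mem_neighborsIn {u : V} : u ∈ neighborsIn G S v ↔ u ∈ S ∧ G.Adj v u := by
  simp [neighborsIn]

theorem neighborsIn_subset : neighborsIn G S v ⊆ S := fun _ hu => (mem_neighborsIn.1 hu).1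

theorem notMem_neighborsIn_self : v ∉ neighborsIn G S v := fun h =>
  G.irrefl (mem_neighborsIn.1 h).2

theorem isIndepSet_neighborsIn (hG : G.CliqueFree 3) (S : Finset V) (v : V) :
    G.IsIndepSet (neighborsIn G S v : Set V) := fun _ hx _ hy hxy =>
  G.isIndepSet_neighborSet_of_triangleFree hG v (mem_neighborsIn.1 hx).2
    (mem_neighborsIn.1 hy).2 hxy

theorem numIndepSetsIn_pos (G : SimpleGraph V) (S : Finset V) : 0 < numIndepSetsIn G S := by
  classical
  exact card_pos.2 ⟨∅, by simp [SimpleGraph.IsIndepSet]⟩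

open Classical in
theorem isIndepSet_insert_iff {I : Finset V} (hI : I ⊆ S) (hvI : v ∉ I) :
    G.IsIndepSet (insert v I : Set V) ↔
      G.IsIndepSet (I : Set V) ∧ I ⊆ S \ insert v (neighborsIn G S v) := by
  rw [SimpleGraph.IsIndepSet, Set.pairwise_insert_of_notMem (by simpa using hvI)]
  refine and_congr_right fun _ => ⟨fun h u hu => ?_, fun h u hu => ?_⟩
  · have huv : u ≠ v := fun huv => hvI (huv ▸ hu)
    simp only [mem_sdiff, mem_insert, mem_neighborsIn]
    exact ⟨hI hu, fun h' => h'.elim huv fun h' => (h u hu).1 h'.2⟩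
  · have hu' := h hu
    simp only [mem_sdiff, mem_insert, mem_neighborsIn, not_or, not_and] at hu'
    exact ⟨hu'.2.2 hu'.1, fun hadj => hu'.2.2 hu'.1 hadj.symm⟩

open Classical in
theorem numIndepSetsIn_erase_add (G : SimpleGraph V) (hv : v ∈ S) :
    numIndepSetsIn G (S.erase v) + numIndepSetsIn G (S \ insert v (neighborsIn G S v)) =
      numIndepSetsIn G S := by
  unfold numIndepSetsIn
  rw [← card_filter_add_card_filter_not
    (s := S.powerset.filter fun I : Finset V => G.IsIndepSet (I : Set V)) (fun I => v ∉ I)]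
  congr 1
  · congr 1
    ext I
    simp only [mem_filter, mem_powerset, subset_erase]
    tauto
  · refine card_nbij' (insert v) (fun I => I.erase v) (fun I hI => ?_) (fun I hI => ?_)
      (fun I hI => ?_) fun I hI => ?_
    all_goals simp only [coe_filter, mem_powerset, mem_filter, Set.mem_ofPred_eq, not_not] at hI ⊢
    · have hIS : I ⊆ S := hI.1.trans sdiff_subset
      have hvI : v ∉ I := fun h => by simpa using hI.1 h
      rw [coe_insert]
      exact ⟨⟨insert_subset hv hIS, (isIndepSet_insert_iff hIS hvI).2 hI.symm⟩,
        mem_insert_self v I⟩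
    · refine ((isIndepSet_insert_iff ((erase_subset v I).trans hI.1.1) (notMem_erase v I)).1
        ?_).symm
      rw [← coe_insert, insert_erase hI.2]
      exact hI.1.2
    · exact erase_insert fun h => by simpa using hI.1 h
    · exact insert_erase hI.2

open Classical in
theorem degreeIn_eq_sum (G : SimpleGraph V) (S : Finset V) (v : V) :
    degreeIn G S v = ∑ u ∈ S, if G.Adj v u then 1 else 0 := by
  rw [degreeIn, neighborsIn, card_filter]

theorem degreeSumIn_mono (G : SimpleGraph V) (h : S ⊆ T) : degreeSumIn G S ≤ degreeSumIn G T := by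
  classical
  simp only [degreeSumIn, degreeIn_eq_sum]
  exact (sum_le_sum fun _ _ => sum_le_sum_of_subset h).trans (sum_le_sum_of_subset h)

open Classical in
theorem degreeSumIn_sdiff_add (hT : T ⊆ S) (hind : G.IsIndepSet (T : Set V)) :
    degreeSumIn G (S \ T) + 2 * ∑ u ∈ T, degreeIn G S u = degreeSumIn G S := by
  simp only [degreeSumIn, degreeIn_eq_sum]
  have hTT : ∑ x ∈ T, ∑ y ∈ T, (if G.Adj x y then 1 else 0) = 0 :=
    sum_eq_zero fun x hx => sum_eq_zero fun y hy => if_neg fun hxy => hind hx hy hxy.ne hxy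
  have hcross : ∑ x ∈ S \ T, ∑ y ∈ T, (if G.Adj x y then 1 else 0) =
      ∑ x ∈ T, ∑ y ∈ S \ T, if G.Adj x y then 1 else 0 := by
    rw [sum_comm]
    simp only [G.adj_comm]
  simp only [← sum_sdiff hT, sum_add_distrib]
  omega

open Classical in
theorem degreeSumIn_erase_add (G : SimpleGraph V) (hv : v ∈ S) :
    degreeSumIn G (S.erase v) + 2 * degreeIn G S v = degreeSumIn G S := by
  have h := degreeSumIn_sdiff_add (G := G) (singleton_subset_iff.2 hv) (by simp)
  rwa [sdiff_singleton_eq_erase, sum_singleton] at h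

open Classical in
theorem degreeSumIn_sdiff_insert_neighborsIn_add_le (hG : G.CliqueFree 3) (S : Finset V) (v : V) :
    degreeSumIn G (S \ insert v (neighborsIn G S v)) + 2 * ∑ u ∈ neighborsIn G S v, degreeIn G S u ≤
      degreeSumIn G S := by
  rw [← degreeSumIn_sdiff_add neighborsIn_subset (isIndepSet_neighborsIn hG S v)]
  gcongr
  exact degreeSumIn_mono G (sdiff_subset_sdiff Subset.rfl (subset_insert v _))

theorem sum_sum_neighborsIn (G : SimpleGraph V) (S : Finset V) (g : V → ℝ) :
    ∑ v ∈ S, ∑ u ∈ neighborsIn G S v, g u = ∑ u ∈ S, degreeIn G S u * g u := by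
  classical
  have hdeg (u : V) : degreeIn G S u * g u = ∑ v ∈ S, if G.Adj v u then g u else 0 := by
    simp only [G.adj_comm _ u]
    rw [← sum_filter, sum_const, nsmul_eq_mul, degreeIn, neighborsIn]
  simp only [hdeg, neighborsIn, sum_filter]
  exact sum_comm

end IndependentSubsets

section ShearerPair

open Finset

theorem card_mul_exp_le_sum_exp {ι : Type*} {s : Finset ι} {a : ι → ℝ} {α : ℝ}
    (ha : #s * α ≤ ∑ i ∈ s, a i) : #s * Real.exp α ≤ ∑ i ∈ s, Real.exp (a i) :=
  calc #s * Real.exp α ≤ ∑ i ∈ s, Real.exp α * (1 + (a i - α)) := by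
        rw [← mul_sum, sum_add_distrib, sum_sub_distrib, sum_const, sum_const, nsmul_eq_mul,
          nsmul_eq_mul, mul_comm]
        gcongr
        linarith
    _ ≤ ∑ i ∈ s, Real.exp α * Real.exp (a i - α) := by
        gcongr with i
        linarith [Real.add_one_le_exp (a i - α)]
    _ = ∑ i ∈ s, Real.exp (a i) := by simp only [← Real.exp_add, add_sub_cancel]

theorem exists_one_le_exp_add_exp_of_card_mul_le_sum {ι : Type*} {s : Finset ι} (hs : s.Nonempty)
    {a b : ι → ℝ} {α β : ℝ} (ha : #s * α ≤ ∑ i ∈ s, a i)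
    (hb : #s * β ≤ ∑ i ∈ s, b i) (h : 1 ≤ Real.exp α + Real.exp β) :
    ∃ i ∈ s, 1 ≤ Real.exp (a i) + Real.exp (b i) := by
  refine exists_le_of_sum_le hs ?_
  calc ∑ _i ∈ s, (1 : ℝ) = #s * 1 := by rw [sum_const, nsmul_eq_mul]
    _ ≤ #s * (Real.exp α + Real.exp β) := by gcongr
    _ ≤ ∑ i ∈ s, (Real.exp (a i) + Real.exp (b i)) := by
        rw [mul_add, sum_add_distrib]
        exact add_le_add (card_mul_exp_le_sum_exp ha) (card_mul_exp_le_sum_exp hb)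

/-- A function `f` and a nonpositive subgradient `p` of `f` on `[0, ∞)` satisfying the inequality
under which Shearer's induction gives at least `exp (n * f d)` independent sets in every
triangle-free graph with `n` vertices and average degree `d`. -/
structure IsShearerPair (f p : ℝ → ℝ) : Prop where
  isSubgradientOn : IsSubgradientOn p f (Set.Ici 0)
  nonpos : ∀ d, p d ≤ 0
  one_le_exp_add_exp : ∀ d, 0 ≤ d →
    1 ≤ Real.exp (-f d - p d * d) + Real.exp (-(1 + d) * f d + p d * (d - d ^ 2))

variable {V : Type*} {G : SimpleGraph V} {S R : Finset V} {f p : ℝ → ℝ} {d : ℝ}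

theorem IsShearerPair.exists_one_le_exp_add_exp (h : IsShearerPair f p) (hS : S.Nonempty)
    (hdS : degreeSumIn G S = #S * d) :
    ∃ v ∈ S, 1 ≤ Real.exp (-f d + p d * (d - 2 * degreeIn G S v)) +
      Real.exp (-(1 + degreeIn G S v) * f d + p d *
        (d + d * degreeIn G S v - 2 * ∑ u ∈ neighborsIn G S v, (degreeIn G S u : ℝ))) := by
  have hcard : (0 : ℝ) < #S := by exact_mod_cast hS.card_pos
  have hd : 0 ≤ d := nonneg_of_mul_nonneg_right (hdS ▸ Nat.cast_nonneg _) hcard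
  have hsum : ∑ v ∈ S, (degreeIn G S v : ℝ) = #S * d := by
    rw [← hdS, degreeSumIn, Nat.cast_sum]
  have hsum_sq : #S * d ^ 2 ≤ ∑ v ∈ S, (degreeIn G S v : ℝ) * degreeIn G S v := by
    have hcs := sq_sum_le_card_mul_sum_sq (s := S) (f := fun v => (degreeIn G S v : ℝ))
    simp only [hsum, sq] at hcs ⊢
    exact le_of_mul_le_mul_left (by linarith) hcard
  refine exists_one_le_exp_add_exp_of_card_mul_le_sum hS (le_of_eq ?_) ?_
    (h.one_le_exp_add_exp d hd)
  · rw [sum_add_distrib, ← mul_sum, sum_sub_distrib, ← mul_sum, hsum]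
    simp only [sum_const, nsmul_eq_mul]
    ring
  · rw [sum_add_distrib, ← sum_mul, sum_neg_distrib, ← mul_sum, sum_sub_distrib, ← mul_sum,
      sum_add_distrib, sum_add_distrib, ← mul_sum, hsum, sum_sum_neighborsIn]
    simp only [sum_const, nsmul_eq_mul]
    linarith [mul_nonneg_of_nonpos_of_nonpos (h.nonpos d) (sub_nonpos.2 hsum_sq)]

theorem IsShearerPair.exp_le_numIndepSetsIn (h : IsShearerPair f p) (hd : 0 ≤ d)
    (hR : #R * f (degreeSumIn G R / #R) ≤ Real.log (numIndepSetsIn G R)) {e : ℝ}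
    (he : degreeSumIn G R ≤ e) :
    Real.exp (#R * f d + p d * (e - #R * d)) ≤ numIndepSetsIn G R := by
  rw [← Real.le_log_iff_exp_le (by exact_mod_cast numIndepSetsIn_pos G R)]
  have hdual : #R * f d + p d * (degreeSumIn G R - #R * d) ≤
      #R * f (degreeSumIn G R / #R) := by
    rcases R.eq_empty_or_nonempty with rfl | hne
    · simp [degreeSumIn]
    · have hcard : (#R : ℝ) ≠ 0 := by exact_mod_cast hne.card_ne_zero
      have hsub := h.isSubgradientOn hd
        (show 0 ≤ (degreeSumIn G R / #R : ℝ) by positivity)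
      calc #R * f d + p d * (degreeSumIn G R - #R * d)
          = #R * (f d + p d * (degreeSumIn G R / #R - d)) := by
            rw [mul_add, mul_left_comm, mul_sub (#R : ℝ), mul_div_cancel₀ _ hcard]
        _ ≤ #R * f (degreeSumIn G R / #R) := by gcongr
  linarith [mul_le_mul_of_nonpos_left he (h.nonpos d)]

theorem IsShearerPair.card_mul_le_log_numIndepSetsIn (h : IsShearerPair f p)
    (hG : G.CliqueFree 3) (S : Finset V) :
    #S * f (degreeSumIn G S / #S) ≤ Real.log (numIndepSetsIn G S) := by
  classical
  induction S using Finset.strongInduction with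
  | H S ih =>
  rcases S.eq_empty_or_nonempty with rfl | hS
  · simpa using Real.log_natCast_nonneg _
  set d : ℝ := degreeSumIn G S / #S
  have hd0 : 0 ≤ d := by positivity
  have hdS : (degreeSumIn G S : ℝ) = #S * d :=
    (mul_div_cancel₀ _ (by exact_mod_cast hS.card_ne_zero)).symm
  obtain ⟨v, hv, hone⟩ := h.exists_one_le_exp_add_exp hS hdS
  set N := neighborsIn G S v
  have hvN : insert v N ⊆ S := insert_subset hv neighborsIn_subset
  have hdeg_erase : (degreeSumIn G (S.erase v) : ℝ) ≤ #S * d - 2 * degreeIn G S v := by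
    rw [← hdS, le_sub_iff_add_le]
    exact_mod_cast (degreeSumIn_erase_add G hv).le
  have hdeg_sdiff : (degreeSumIn G (S \ insert v N) : ℝ) ≤
      #S * d - 2 * ∑ u ∈ N, (degreeIn G S u : ℝ) := by
    rw [← hdS, le_sub_iff_add_le]
    exact_mod_cast degreeSumIn_sdiff_insert_neighborsIn_add_le hG S v
  have h_erase := h.exp_le_numIndepSetsIn hd0 (ih _ (erase_ssubset hv)) hdeg_erase
  have h_sdiff := h.exp_le_numIndepSetsIn hd0
    (ih _ (sdiff_ssubset hvN (insert_nonempty v N))) hdeg_sdiff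
  rw [cast_card_erase_of_mem hv] at h_erase
  rw [cast_card_sdiff hvN, card_insert_of_notMem notMem_neighborsIn_self] at h_sdiff
  rw [Real.le_log_iff_exp_le (by exact_mod_cast numIndepSetsIn_pos G S),
    ← numIndepSetsIn_erase_add G hv]
  push_cast at h_sdiff ⊢
  refine le_trans ?_ (add_le_add h_erase h_sdiff)
  refine (le_mul_of_one_le_right (Real.exp_pos _).le hone).trans_eq ?_
  rw [mul_add, ← Real.exp_add, ← Real.exp_add]
  simp only [degreeIn]
  ring_nf

theorem isShearerPair_segmentMean_expNegW :
    IsShearerPair (segmentMean expNegW 2) (segmentSlope expNegWDeriv 2) where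
  isSubgradientOn := isSubgradientOn_segmentMean_expNegW
  nonpos := segmentSlope_nonpos expNegWDeriv_nonpos 2
  one_le_exp_add_exp d hd := by
    have hode := segmentMean_expNegW_add two_pos hd
    have hx := expNegW_pos d
    have hexp : Real.exp (segmentMean expNegW 2 d + segmentSlope expNegWDeriv 2 d * d) ≤
        1 + expNegW d := by
      rw [← Real.le_log_iff_exp_le (by positivity)]
      linarith [expNegW_add_two_mul_segmentSlope_le hd]
    set f := segmentMean expNegW 2 d
    set p := segmentSlope expNegWDeriv 2 d
    calc 1 = Real.exp (-f - p * d) * Real.exp (f + p * d) := by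
          rw [← Real.exp_add, neg_sub_left, add_comm (p * d), neg_add_cancel, Real.exp_zero]
      _ ≤ Real.exp (-f - p * d) * (1 + Real.exp (-(d * expNegW d))) := by
          rw [exp_neg_mul_expNegW hd]
          gcongr
      _ = Real.exp (-f - p * d) + Real.exp (-(1 + d) * f + p * (d - d ^ 2)) := by
          rw [mul_add, mul_one, ← Real.exp_add]
          congr 2
          linear_combination d * hode

end ShearerPair

section LowerBound

open Finset

theorem degreeIn_univ_eq_degree {V : Type*} [Fintype V] (G : SimpleGraph V) (v : V)
    [Fintype (G.neighborSet v)] : degreeIn G univ v = G.degree v := by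
  rw [degreeIn, ← SimpleGraph.card_neighborFinset_eq_degree]
  congr 1
  ext u
  simp [mem_neighborsIn]

theorem avgDegree_eq_degreeSumIn_div {V : Type} [Fintype V] (G : SimpleGraph V) :
    avgDegree G = degreeSumIn G univ / Fintype.card V := by
  simp only [avgDegree, degreeSumIn, Nat.cast_sum, ← degreeIn_univ_eq_degree]

theorem numIndepSetsIn_univ {V : Type} [Fintype V] (G : SimpleGraph V) :
    numIndepSetsIn G univ = numIndepSets G := by
  rw [numIndepSetsIn, numIndepSets, powerset_univ]

theorem lowerCurve_le_of_mem {d x : ℝ} (hd : 0 ≤ d) (hx : x ∈ logIndepDensities d) :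
    lowerCurve d ≤ x := by
  obtain ⟨V, _, _, G, hG, hdeg, rfl⟩ := hx
  have hdeg0 : 0 ≤ avgDegree G := by unfold avgDegree; positivity
  have hcard : (0 : ℝ) < Fintype.card V := by exact_mod_cast Fintype.card_pos
  have h := isShearerPair_segmentMean_expNegW.card_mul_le_log_numIndepSetsIn hG univ
  rw [card_univ, ← avgDegree_eq_degreeSumIn_div, numIndepSetsIn_univ] at h
  calc lowerCurve d = segmentMean expNegW 2 d := lowerCurve_eq_segmentMean hd
    _ ≤ segmentMean expNegW 2 (avgDegree G) :=
        isSubgradientOn_segmentMean_expNegW.antitoneOn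
          (fun t _ => segmentSlope_nonpos expNegWDeriv_nonpos 2 t) hdeg0 hd hdeg
    _ ≤ Real.log (numIndepSets G) / Fintype.card V := by rwa [le_div_iff₀' hcard]

end LowerBound

section CappedTriangleFreeProcess

open Finset SimpleGraph

variable {V : Type*} {G : SimpleGraph V} {D m : ℕ} {u v : V}

theorem cliqueFree_three_sup_edge (hG : G.CliqueFree 3) (h : ∀ w, G.Adj w u → ¬G.Adj w v) :
    (G ⊔ edge u v).CliqueFree 3 := by
  classical
  have not_adj (a b c : V) (hab : G.Adj a b) (hac : G.Adj a c) : ¬G.Adj b c := fun hbc =>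
    hG {a, b, c} (is3Clique_triple_iff.2 ⟨hab, hac, hbc⟩)
  intro s hs
  obtain ⟨a, b, c, hab, hac, hbc, -⟩ := is3Clique_iff.1 hs
  simp only [sup_adj, edge_adj] at hab hac hbc
  grind [SimpleGraph.adj_comm]

theorem degree_sup_edge_left_le (G : SimpleGraph V) (u v : V) [Fintype (G.neighborSet u)]
    [Fintype ((G ⊔ edge u v).neighborSet u)] : (G ⊔ edge u v).degree u ≤ G.degree u + 1 := by
  classical
  rw [← card_neighborFinset_eq_degree, ← card_neighborFinset_eq_degree]
  refine (card_le_card fun y hy => ?_).trans (card_insert_le v (G.neighborFinset u))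
  simp only [mem_neighborFinset, mem_insert, sup_adj, edge_adj] at hy ⊢
  grind

theorem degree_sup_edge_of_ne {x : V} [Fintype (G.neighborSet x)]
    [Fintype ((G ⊔ edge u v).neighborSet x)] (hu : x ≠ u) (hv : x ≠ v) :
    (G ⊔ edge u v).degree x = G.degree x := by
  rw [← card_neighborFinset_eq_degree, ← card_neighborFinset_eq_degree]
  congr 1
  ext y
  simp [edge_adj, hu, hv]

variable [Fintype V]

open Classical in
/-- The invariant of the degree-capped triangle-free process after at most `m` added edges. -/
structure IsAdmissible (G : SimpleGraph V) (D m : ℕ) : Prop where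
  cliqueFree : G.CliqueFree 3
  degree_le : ∀ v, G.degree v ≤ D
  card_edgeFinset_le : #G.edgeFinset ≤ m

open Classical in
/-- The vertices `u` and `v` may be joined without creating a triangle or a vertex of degree greater
than `D`. Adjacent vertices are allowed: joining them changes nothing. -/
structure CanJoin (G : SimpleGraph V) (D : ℕ) (u v : V) : Prop where
  ne : u ≠ v
  degree_left_lt : G.degree u < D
  degree_right_lt : G.degree v < D
  not_adj : ∀ w, G.Adj w u → ¬G.Adj w v

open Classical in
/-- One step of the degree-capped triangle-free process: join the pair `q` if this is allowed. -/
noncomputable def processStep (G : SimpleGraph V) (D : ℕ) (q : V × V) : SimpleGraph V :=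
  if CanJoin G D q.1 q.2 then G ⊔ edge q.1 q.2 else G

theorem isAdmissible_bot (D : ℕ) : IsAdmissible (⊥ : SimpleGraph V) D 0 where
  cliqueFree := cliqueFree_bot (by norm_num)
  degree_le v := by simp
  card_edgeFinset_le := by simp

theorem IsAdmissible.mono {m' : ℕ} (h : IsAdmissible G D m) (hm : m ≤ m') :
    IsAdmissible G D m' :=
  ⟨h.cliqueFree, h.degree_le, h.card_edgeFinset_le.trans hm⟩

theorem IsAdmissible.sup_edge (h : IsAdmissible G D m) (huv : CanJoin G D u v) :
    IsAdmissible (G ⊔ edge u v) D (m + 1) where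
  cliqueFree := cliqueFree_three_sup_edge h.cliqueFree huv.not_adj
  degree_le x := by
    classical
    by_cases hu : x = u
    · subst hu
      convert Nat.le_trans (degree_sup_edge_left_le G x v) huv.degree_left_lt
    by_cases hv : x = v
    · subst hv
      rw [edge_comm]
      convert Nat.le_trans (degree_sup_edge_left_le G x u) huv.degree_right_lt
    convert h.degree_le x using 1
    convert degree_sup_edge_of_ne hu hv
  card_edgeFinset_le := by
    classical
    by_cases hadj : G.Adj u v
    · rw [sup_edge_of_adj G hadj]
      exact h.card_edgeFinset_le.trans m.le_succ
    · convert Nat.succ_le_succ h.card_edgeFinset_le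
      convert card_edgeFinset_sup_edge G hadj huv.ne

theorem isAdmissible_processStep (h : IsAdmissible G D m) (q : V × V) :
    IsAdmissible (processStep G D q) D (m + 1) := by
  unfold processStep
  split_ifs with hq
  · exact h.sup_edge hq
  · exact h.mono m.le_succ

theorem le_processStep (G : SimpleGraph V) (D : ℕ) (q : V × V) : G ≤ processStep G D q := by
  unfold processStep
  split_ifs
  · exact le_sup_left
  · exact le_rfl

theorem not_isIndepSet_processStep {I : Finset V} {q : V × V} (hq : CanJoin G D q.1 q.2)
    (hqI : q ∈ I ×ˢ I) : ¬(processStep G D q).IsIndepSet (I : Set V) := fun hI => by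
  rw [mem_product] at hqI
  refine hI hqI.1 hqI.2 hq.ne ?_
  simp [processStep, hq, edge_adj, hq.ne]

open Classical in
theorem card_filter_le_degree_mul_le (G : SimpleGraph V) (D : ℕ) :
    #{v | D ≤ G.degree v} * D ≤ 2 * #G.edgeFinset :=
  calc #{v | D ≤ G.degree v} * D ≤ ∑ v with D ≤ G.degree v, G.degree v := by
        rw [← smul_eq_mul]
        exact card_nsmul_le_sum _ _ _ fun v hv => (mem_filter.1 hv).2
    _ ≤ ∑ v, G.degree v := sum_le_sum_of_subset (filter_subset _ _)
    _ = 2 * #G.edgeFinset := G.sum_degrees_eq_twice_card_edges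

open Classical in
theorem card_not_canJoin_le (hdeg : ∀ v, G.degree v ≤ D) :
    #{q : V × V | ¬CanJoin G D q.1 q.2} ≤
      Fintype.card V * (1 + 2 * #{v | D ≤ G.degree v} + D ^ 2) := by
  set H : Finset V := {v | D ≤ G.degree v} with hH
  set P : Finset (V × V) := univ.biUnion fun w => G.neighborFinset w ×ˢ G.neighborFinset w
  have hsub : ({q | ¬CanJoin G D q.1 q.2} : Finset (V × V)) ⊆
      univ.diag ∪ (H ×ˢ univ ∪ (univ ×ˢ H ∪ P)) := by
    rintro ⟨u, v⟩ hq
    simp only [mem_filter, mem_univ, true_and] at hq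
    by_contra hcon
    simp only [P, hH, mem_union, mem_diag, mem_product, mem_filter, mem_biUnion,
      mem_neighborFinset, mem_univ, true_and, and_true, not_or, not_le, not_exists,
      not_and] at hcon
    exact hq ⟨hcon.1, hcon.2.1, hcon.2.2.1, hcon.2.2.2⟩
  have hP : #P ≤ Fintype.card V * D ^ 2 := by
    refine card_biUnion_le_card_mul _ _ _ fun w _ => ?_
    rw [card_product, card_neighborFinset_eq_degree, sq]
    exact Nat.mul_le_mul (hdeg w) (hdeg w)
  calc #{q : V × V | ¬CanJoin G D q.1 q.2}
      ≤ #(univ.diag ∪ (H ×ˢ univ ∪ (univ ×ˢ H ∪ P))) := card_le_card hsub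
    _ ≤ #(univ : Finset V).diag + (#(H ×ˢ univ) + (#(univ ×ˢ H) + #P)) := by
        refine (card_union_le _ _).trans ?_
        gcongr
        refine (card_union_le _ _).trans ?_
        gcongr
        exact card_union_le _ _
    _ ≤ Fintype.card V + (#H * Fintype.card V + (Fintype.card V * #H +
          Fintype.card V * D ^ 2)) := by
        rw [diag_card, card_product, card_product, card_univ]
        gcongr
    _ = Fintype.card V * (1 + 2 * #H + D ^ 2) := by ring

open Classical in
/-- The sum of `w I ^ r` over the independent sets `I` of `G`: the potential function of the
process, `r` being the number of steps still to be made. -/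
noncomputable def indepWeight (G : SimpleGraph V) (w : Finset V → ℝ) (r : ℕ) : ℝ :=
  ∑ I ∈ univ.filter (fun I : Finset V => G.IsIndepSet I), w I ^ r

open Classical in
theorem exists_indepWeight_le {Q : Type*} [Fintype Q] [Nonempty Q] {next : Q → SimpleGraph V}
    (hle : ∀ q, G ≤ next q) {w : Finset V → ℝ}
    (hw : ∀ I : Finset V, G.IsIndepSet (I : Set V) →
      #{q | (next q).IsIndepSet (I : Set V)} ≤ Fintype.card Q * w I) (r : ℕ) :
    ∃ q, indepWeight (next q) w r ≤ indepWeight G w (r + 1) := by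
  have hQ : (0 : ℝ) < Fintype.card Q := by exact_mod_cast Fintype.card_pos
  have hsum : ∑ q, indepWeight (next q) w r ≤ ∑ _q : Q, indepWeight G w (r + 1) := by
    rw [sum_const, nsmul_eq_mul, card_univ]
    simp only [indepWeight, sum_filter]
    rw [sum_comm, mul_sum]
    refine sum_le_sum fun I _ => ?_
    rw [← sum_filter, sum_const, nsmul_eq_mul]
    split_ifs with hI
    · have hwI : 0 ≤ w I := nonneg_of_mul_nonneg_right ((Nat.cast_nonneg _).trans (hw I hI)) hQ
      rw [pow_succ', ← mul_assoc]
      exact mul_le_mul_of_nonneg_right (hw I hI) (pow_nonneg hwI r)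
    · have hempty : ({q | (next q).IsIndepSet (I : Set V)} : Finset Q) = ∅ :=
        filter_eq_empty_iff.2 fun q _ hq => hI fun a ha b hb hab hadj =>
          hq ha hb hab (hle q hadj)
      simp [hempty]
  obtain ⟨q, -, hq⟩ := exists_le_of_sum_le univ_nonempty hsum
  exact ⟨q, hq⟩

open Classical in
theorem card_isIndepSet_processStep_le (G : SimpleGraph V) (D : ℕ) (I : Finset V) :
    (#{q | (processStep G D q).IsIndepSet (I : Set V)} : ℝ) ≤
      Fintype.card V ^ 2 - #I ^ 2 + #{q : V × V | ¬CanJoin G D q.1 q.2} := by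
  have hsub : ({q | (processStep G D q).IsIndepSet (I : Set V)} : Finset (V × V)) ⊆
      (I ×ˢ I)ᶜ ∪ univ.filter fun q => ¬CanJoin G D q.1 q.2 := by
    intro q hq
    simp only [mem_union, mem_compl, mem_filter, mem_univ, true_and] at hq ⊢
    by_contra! hcon
    exact not_isIndepSet_processStep hcon.2 hcon.1 hq
  have hcompl : (#(I ×ˢ I)ᶜ : ℝ) = Fintype.card V ^ 2 - #I ^ 2 := by
    rw [card_compl, Nat.cast_sub (card_le_univ _), Fintype.card_prod, card_product]
    push_cast
    ring
  rw [← hcompl]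
  exact_mod_cast (card_le_card hsub).trans (card_union_le _ _)

/-- The error term, relative to the `n ^ 2` pairs of vertices, coming from the pairs that cannot be
joined in a process with degree cap `D` and at most `m` edges on `n` vertices. -/
noncomputable def processError (n D m : ℕ) : ℝ := (1 + 4 * m / D + D ^ 2) / n

theorem processError_nonneg (n D m : ℕ) : 0 ≤ processError n D m := by
  unfold processError
  positivity

theorem card_isIndepSet_processStep_le_of_isAdmissible [Nonempty V] (h : IsAdmissible G D m)
    (hD : 0 < D) (I : Finset V) :
    open Classical in
    (#{q | (processStep G D q).IsIndepSet (I : Set V)} : ℝ) ≤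
      Fintype.card (V × V) *
        (1 - (#I / Fintype.card V) ^ 2 + processError (Fintype.card V) D m) := by
  classical
  have hn : (Fintype.card V : ℝ) ≠ 0 := by exact_mod_cast Fintype.card_ne_zero
  have hhigh : (#{v | D ≤ G.degree v} : ℝ) ≤ 2 * m / D := by
    rw [le_div_iff₀ (by exact_mod_cast hD)]
    exact_mod_cast (card_filter_le_degree_mul_le G D).trans
      (Nat.mul_le_mul_left 2 h.card_edgeFinset_le)
  calc (#{q | (processStep G D q).IsIndepSet (I : Set V)} : ℝ)
      ≤ Fintype.card V ^ 2 - #I ^ 2 + #{q : V × V | ¬CanJoin G D q.1 q.2} :=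
        card_isIndepSet_processStep_le G D I
    _ ≤ Fintype.card V ^ 2 - #I ^ 2 +
          Fintype.card V * (1 + 2 * #{v | D ≤ G.degree v} + D ^ 2) := by
        gcongr
        exact_mod_cast card_not_canJoin_le h.degree_le
    _ ≤ Fintype.card V ^ 2 - #I ^ 2 + Fintype.card V * (1 + 2 * (2 * m / D) + D ^ 2) := by
        gcongr
    _ = Fintype.card (V × V) *
          (1 - (#I / Fintype.card V) ^ 2 + processError (Fintype.card V) D m) := by
        rw [Fintype.card_prod, processError]
        push_cast
        field_simp
        ring

theorem IsAdmissible.exists_card_isIndepSet_le [Nonempty V] {k r : ℕ} (h : IsAdmissible G D k)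
    (hD : 0 < D) (hkr : k + r = m) :
    open Classical in
    ∃ G' : SimpleGraph V, IsAdmissible G' D m ∧
      (#(univ.filter fun I : Finset V => G'.IsIndepSet I) : ℝ) ≤ indepWeight G
        (fun I => 1 - (#I / Fintype.card V) ^ 2 + processError (Fintype.card V) D m) r := by
  induction r generalizing G k with
  | zero => exact ⟨G, hkr ▸ h, by simp [indepWeight]⟩
  | succ r ih =>
    obtain ⟨q, hq⟩ := exists_indepWeight_le (le_processStep G D)
      (fun I _ => card_isIndepSet_processStep_le_of_isAdmissible
        (h.mono (hkr ▸ k.le_add_right _)) hD I) r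
    obtain ⟨G', hG', hcard⟩ := ih (isAdmissible_processStep h q) (by omega)
    exact ⟨G', hG', hcard.trans hq⟩

theorem exists_isAdmissible_card_isIndepSet_le [Nonempty V] (hD : 0 < D) (m : ℕ) :
    open Classical in
    ∃ G : SimpleGraph V, IsAdmissible G D m ∧
      (#(univ.filter fun I : Finset V => G.IsIndepSet I) : ℝ) ≤
        ∑ I : Finset V,
          (1 - (#I / Fintype.card V : ℝ) ^ 2 + processError (Fintype.card V) D m) ^ m := by
  obtain ⟨G, hG, hcard⟩ := (isAdmissible_bot D).exists_card_isIndepSet_le (V := V) hD (zero_add m)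
  refine ⟨G, hG, hcard.trans_eq ?_⟩
  simp [indepWeight, IsIndepSet, Set.Pairwise]

end CappedTriangleFreeProcess

section UpperBound

open Finset Filter Topology

theorem one_sub_sq_add_pow_le {n k d ε : ℝ} {m : ℕ} (hn : 0 < n) (hk : 0 ≤ k) (hkn : k ≤ n)
    (hε : 0 ≤ ε) (hd : 0 ≤ d) (hm : d * n ≤ 2 * (m + 1)) (x : ℝ) :
    (1 - (k / n) ^ 2 + ε) ^ m ≤
      Real.exp (m * ε + 1 + n * (d * x ^ 2 / 2)) * Real.exp (k * -(d * x)) := by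
  have hratio : (k / n) ^ 2 ≤ 1 := pow_le_one₀ (by positivity) ((div_le_one hn).2 hkn)
  have hfloor : d * n / 2 * (k / n) ^ 2 ≤ m * (k / n) ^ 2 + 1 :=
    calc d * n / 2 * (k / n) ^ 2 ≤ (m + 1) * (k / n) ^ 2 := by gcongr; linarith
      _ ≤ m * (k / n) ^ 2 + 1 := by linarith
  have hsquare : d * n / 2 * (k / n) ^ 2 =
      k * (d * x) - n * (d * x ^ 2 / 2) + d * n / 2 * (k / n - x) ^ 2 := by
    field_simp
    ring
  calc (1 - (k / n) ^ 2 + ε) ^ m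
      ≤ Real.exp (ε - (k / n) ^ 2) ^ m := by
        refine pow_le_pow_left₀ (by linarith) ?_ m
        linarith [Real.add_one_le_exp (ε - (k / n) ^ 2)]
    _ = Real.exp (m * (ε - (k / n) ^ 2)) := (Real.exp_nat_mul _ m).symm
    _ ≤ Real.exp (m * ε + 1 + n * (d * x ^ 2 / 2) + k * -(d * x)) := by
        have : 0 ≤ d * n / 2 * (k / n - x) ^ 2 := by positivity
        gcongr
        linarith
    _ = _ := Real.exp_add _ _

theorem sum_pow_card_le_exp (V : Type*) [Fintype V] {y : ℝ} (hy : 0 ≤ y) :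
    ∑ I : Finset V, y ^ #I ≤ Real.exp (Fintype.card V * y) :=
  calc ∑ I : Finset V, y ^ #I = (y + 1) ^ Fintype.card V := by
        simpa using sum_pow_mul_eq_add_pow y 1 (univ : Finset V)
    _ ≤ Real.exp y ^ Fintype.card V := by
        gcongr
        exact Real.add_one_le_exp y
    _ = Real.exp (Fintype.card V * y) := (Real.exp_nat_mul _ _).symm

theorem sum_one_sub_sq_add_pow_le (V : Type*) [Fintype V] [Nonempty V] {d ε : ℝ} {m : ℕ}
    (hε : 0 ≤ ε) (hd : 0 ≤ d) (hm : d * Fintype.card V ≤ 2 * (m + 1)) (x : ℝ) :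
    ∑ I : Finset V, (1 - (#I / Fintype.card V : ℝ) ^ 2 + ε) ^ m ≤
      Real.exp (m * ε + 1 + Fintype.card V * (Real.exp (-(d * x)) + d * x ^ 2 / 2)) :=
  calc ∑ I : Finset V, (1 - (#I / Fintype.card V : ℝ) ^ 2 + ε) ^ m
      ≤ ∑ I : Finset V, Real.exp (m * ε + 1 + Fintype.card V * (d * x ^ 2 / 2)) *
          Real.exp (-(d * x)) ^ #I := by
        gcongr with I
        rw [← Real.exp_nat_mul]
        exact one_sub_sq_add_pow_le (by exact_mod_cast Fintype.card_pos) (by positivity)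
          (by exact_mod_cast card_le_univ I) hε hd hm x
    _ ≤ Real.exp (m * ε + 1 + Fintype.card V * (d * x ^ 2 / 2)) *
          Real.exp (Fintype.card V * Real.exp (-(d * x))) := by
        rw [← mul_sum]
        gcongr
        exact sum_pow_card_le_exp V (Real.exp_pos _).le
    _ = _ := by
        rw [← Real.exp_add]
        ring_nf

theorem avgDegree_eq_two_mul_card_edgeFinset_div {V : Type} [Fintype V] (G : SimpleGraph V)
    [Fintype G.edgeSet] : avgDegree G = 2 * #G.edgeFinset / Fintype.card V := by
  classical
  rw [avgDegree, ← Nat.cast_sum]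
  congr 1
  convert congrArg (Nat.cast (R := ℝ)) G.sum_degrees_eq_twice_card_edges
  rw [Nat.cast_mul, Nat.cast_two]
  congr!

theorem extremalF_le_add {d : ℝ} (hd : 0 ≤ d) {D n : ℕ} (hD : 0 < D) (hn : 0 < n) :
    extremalF d ≤ upperCurve d + d ^ 2 / D + (1 + d / 2 * (1 + D ^ 2)) / n := by
  classical
  have : Nonempty (Fin n) := ⟨⟨0, hn⟩⟩
  have hn' : (0 : ℝ) < n := by exact_mod_cast hn
  set m := ⌊d * n / 2⌋₊
  have hm : (m : ℝ) ≤ d * n / 2 := Nat.floor_le (by positivity)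
  have hm' : d * n ≤ 2 * (m + 1) := by linarith [Nat.lt_floor_add_one (d * n / 2)]
  obtain ⟨G, hG, hcard⟩ := exists_isAdmissible_card_isIndepSet_le (V := Fin n) hD m
  have hsum := sum_one_sub_sq_add_pow_le (Fin n) (processError_nonneg n D m) hd
    (by rwa [Fintype.card_fin]) (expNegW d)
  rw [Fintype.card_fin] at hcard hsum
  rw [exp_neg_mul_expNegW hd, ← upperCurve_eq_expNegW hd] at hsum
  have hpos : (0 : ℝ) < numIndepSets G := by
    exact_mod_cast numIndepSetsIn_univ G ▸ numIndepSetsIn_pos G univ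
  have havg : avgDegree G ≤ d := by
    rw [avgDegree_eq_two_mul_card_edgeFinset_div, Fintype.card_fin, div_le_iff₀ hn']
    linarith [(Nat.cast_le (α := ℝ)).2 hG.card_edgeFinset_le]
  calc extremalF d ≤ Real.log (numIndepSets G) / Fintype.card (Fin n) :=
        csInf_le ⟨0, fun _ => logIndepDensities_nonneg⟩
          ⟨Fin n, inferInstance, inferInstance, G, hG.cliqueFree, havg, rfl⟩
    _ ≤ (m * processError n D m + 1 + n * upperCurve d) / n := by
        rw [Fintype.card_fin]
        gcongr
        exact (Real.log_le_iff_le_exp hpos).2 (hcard.trans hsum)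
    _ ≤ (d * n / 2 * ((1 + 4 * (d * n / 2) / D + D ^ 2) / n) + 1 + n * upperCurve d) / n := by
        unfold processError
        gcongr
    _ = upperCurve d + d ^ 2 / D + (1 + d / 2 * (1 + D ^ 2)) / n := by
        have : (D : ℝ) ≠ 0 := by exact_mod_cast hD.ne'
        field_simp
        ring

theorem extremalF_le_upperCurve {d : ℝ} (hd : 0 ≤ d) : extremalF d ≤ upperCurve d := by
  have hle (D : ℕ) (hD : 0 < D) : extremalF d ≤ upperCurve d + d ^ 2 / D := by
    have hlim := (tendsto_const_div_atTop_nhds_zero_nat (1 + d / 2 * (1 + (D : ℝ) ^ 2))).const_add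
      (upperCurve d + d ^ 2 / D)
    rw [add_zero] at hlim
    exact ge_of_tendsto hlim ((eventually_gt_atTop 0).mono fun n hn => extremalF_le_add hd hD hn)
  have hlim := (tendsto_const_div_atTop_nhds_zero_nat (d ^ 2)).const_add (upperCurve d)
  rw [add_zero] at hlim
  exact ge_of_tendsto hlim ((eventually_gt_atTop 0).mono hle)

end UpperBound

/-- The first two conjuncts say that the values which the two curves are given at `d = 2` and
`d = 0` are those of the continuous extensions to `[0, ∞)`. -/
theorem theorem1 :
    ContinuousOn lowerCurve (Set.Ici 0) ∧ ContinuousOn upperCurve (Set.Ici 0) ∧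
      ∀ d : ℝ, 0 ≤ d → lowerCurve d ≤ extremalF d ∧ extremalF d ≤ upperCurve d := by
  refine ⟨continuousOn_lowerCurve, continuousOn_upperCurve, fun d hd =>
    ⟨?_, extremalF_le_upperCurve hd⟩⟩
  exact le_csInf (logIndepDensities_nonempty hd) fun x hx => lowerCurve_le_of_mem hd hx
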